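/- For a word $x$ of length $n$ over a finite alphabet $\Sigma$ with $b$ symbols and an integer $0\le m\le n$, let $$h_x(m)=\min\{k:\ \text{there is a } k\text{-state NFA } M \text{ with } x\in L(M)\text{ and } |L(M)\cap\Sigma^n|\le b^m\},$$ where an NFA has one initial state, any set of accepting states and no $\varepsilon$-transitions. Let $\mathcal H(p)=-p\log_2 p-(1-p)\log_2(1-p)$ on $[0,1]$ (with $0\log_2 0=0$), let $\mathcal H^{-1}:[0,1]\to[0,\tfrac12]$ be the inverse of its restriction to $[0,\tfrac12]$, and put $$\alpha=\frac{4}{\sqrt3}\left(2-\mathcal H\left(\tfrac12-\tfrac{\sqrt3}{4}\right)\right).$$ **Theorem.** (i) For every finite alphabet and every word $x$ of length $n$, $h_x$ is a well-defined function $h_x:[0,n]\to[0,\lfloor n/2\rfloor+1]$ on integers. (ii) For binary words, let $$\tilde h(a)=\limsup_{n\to\infty}\max_{|x|=n}\frac{h_x([a\cdot n])}{n}\qquad(0\le a\le 1),$$ where $[y]$ is the nearest integer to $y$ (halves rounded up). Then $\tilde h:[0,1]\to[0,\tfrac12]$, and for all $a\in[0,1]$ $$\tilde h(a)\le u(a):=\begin{cases}\frac12-\mathcal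 H^{-1}(a) & 0\le a\le \mathcal H(\frac12-\frac{\sqrt3}{4})\approx 0.35,\\[2pt] \frac{2-a}{\alpha} & \mathcal H(\frac12-\frac{\sqrt3}{4})\le a\le\frac{\alpha-2}{\alpha-1}\approx 0.64,\\[2pt] 1-a & \frac{\alpha-2}{\alpha-1}\le a\le 1,\end{cases}$$ the cases agreeing where they overlap. Moreover $\alpha=\mathcal H'(\tfrac12-\tfrac{\sqrt3}{4})\approx 3.79994$. The two approximations with two decimals hold with error less than $0.005$, and the one for $\alpha$ with error less than $5\cdot10^{-6}$. (iii) The function $u$ is a bijection from $[0,1]$ onto $[0,\tfrac12]$, with inverse $$u^{-1}(p)=\begin{cases}\mathcal H(\frac12-p) & \frac{\sqrt3}{4}\le p\le\frac12,\\[2pt] 2-\alpha p & \frac1{\alpha-1}\le p\le\frac{\sqrt3}{4},\\[2pt] 1-p & 0\le p\le\frac1{\alpha-1},\end{cases}$$ the cases agreeing where they overlap. -/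

import Mathlib

/-- `AcceptsWithin x m k`: some nondeterministic finite automaton with exactly `k` states
(one initial state, any set of accepting states, no `ε`-transitions) over an alphabet of
`b` symbols accepts `x` and accepts at most `b ^ m` words of length `|x|`. -/
def AcceptsWithin {A : Type*} [Fintype A] (x : List A) (m k : ℕ) : Prop :=
  ∃ M : NFA A (Fin k), (∃ s, M.start = {s}) ∧ x ∈ M.accepts ∧
    {w : List A | w ∈ M.accepts ∧ w.length = x.length}.ncard ≤ Fintype.card A ^ m

/-- The automatic structure function `h_x(m)`. -/
noncomputable def structureFunction {A : Type*} [Fintype A] (x : List A) (m : ℕ) : ℕ :=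
  sInf {k : ℕ | AcceptsWithin x m k}

/-- `h̃(a) = limsup_n max_{|x| = n} h_x([a n]) / n` over binary words `x`, where `[·]` is the
nearest integer. The supremum is over a finite nonempty set, and since `h_x ≤ |x| / 2 + 1` the
sequence is bounded, so that this is the usual upper limit. -/
noncomputable def hTilde (a : ℝ) : ℝ :=
  Filter.limsup
    (fun n : ℕ => ⨆ x : Fin n → Bool,
      (structureFunction (List.ofFn x) (round (a * n)).toNat : ℝ) / n)
    Filter.atTop

/-- The binary entropy function in bits. -/
noncomputable def entropy (p : ℝ) : ℝ := Real.binEntropy p / Real.log 2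

theorem entropy_eq (p : ℝ) :
    entropy p = -p * Real.logb 2 p - (1 - p) * Real.logb 2 (1 - p) := by
  simp only [entropy, Real.binEntropy, Real.logb, Real.log_inv]
  ring

/-- The inverse of the entropy function, `[0, 1] → [0, 1/2]`. -/
noncomputable def entropyInv : ℝ → ℝ := Function.invFunOn entropy (Set.Icc 0 (1 / 2))

theorem entropyInv_eq_iff {x y : ℝ} (hy : y ∈ Set.Icc (0 : ℝ) 1) :
    entropyInv y = x ↔ entropy x = y ∧ 0 ≤ x ∧ x ≤ 1 / 2 := by
  have hl : 0 < Real.log 2 := Real.log_pos (by norm_num)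
  have hinj : Set.InjOn entropy (Set.Icc 0 (1 / 2)) := by
    intro u hu v hv h
    rw [one_div] at hu hv
    exact Real.binEntropy_strictMonoOn.injOn hu hv ((div_left_inj' hl.ne').1 h)
  have hc : ContinuousOn entropy (Set.Icc 0 (1 / 2)) :=
    (Real.binEntropy_continuous.div_const _).continuousOn
  have hsurj : y ∈ entropy '' Set.Icc 0 (1 / 2) := by
    refine intermediate_value_Icc (by norm_num) hc ?_
    have h0 : entropy 0 = 0 := by simp [entropy]
    have h1 : entropy (1 / 2) = 1 := by
      simp [entropy, Real.binEntropy_two_inv, hl.ne']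
    rwa [h0, h1]
  constructor
  · rintro rfl
    exact ⟨Function.invFunOn_eq hsurj, Function.invFunOn_mem hsurj⟩
  · rintro ⟨h, hx⟩
    exact hinj (Function.invFunOn_mem hsurj) hx ((Function.invFunOn_eq hsurj).trans h.symm)

/-- The constant `α`. -/
noncomputable def alphaConst : ℝ :=
  4 / √3 * (2 - entropy (1 / 2 - √3 / 4))

/-- The function `u`, used on `[0, 1]`. -/
noncomputable def upperBound (a : ℝ) : ℝ :=
  if a ≤ entropy (1 / 2 - √3 / 4) then 1 / 2 - entropyInv a
  else if a ≤ (alphaConst - 2) / (alphaConst - 1) then (2 - a) / alphaConst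
  else 1 - a

/-- The function `u⁻¹`, used on `[0, 1/2]`. -/
noncomputable def upperBoundInv (p : ℝ) : ℝ :=
  if √3 / 4 ≤ p then entropy (1 / 2 - p)
  else if 1 / (alphaConst - 1) ≤ p then 2 - alphaConst * p
  else 1 - p

/-! The upper bounds come from two explicit automata. The first reads `x` along the path `0, …, K`,
loops at `K`, and returns to a state `e ≤ 1` along the same path. Only its loop accepts letters that
are not prescribed by a position on the path. An accepted word labels a walk from `0` to `e`, and if
`n + e` is odd then every such walk of length `n` uses the loop an odd number of times. Recording
this parity unfolds the path into two copies joined by the loop, so the walk has to cross both.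

The walks are counted by a positive supersolution φ of the transfer operator, with growth rate `w +
w⁻¹` and φ equal to `1` at the start (`foldedPotential_step`, `ncard_foldedWords_le`). Hence at most
`(w + w⁻¹)^n / (a * w^(2K - e))` words are accepted. With one loop letter and one loop traversal for
`x`, letting `w → ∞` leaves one word, which gives `⌊n/2⌋ + 1`. With both binary letters on the loop,
`w² = (1 - q)/q` and `K ≈ (1/2 - q)n`, the bound is `2^(H(q)n)` up to a constant factor that a
bounded increase of `K` absorbs. So `h̃(H(q)) ≤ 1/2 - q` for `0 < q < 1/5`.

The second automaton prescribes the first `n - m` letters and gives `h̃(a) ≤ 1 - a`.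

The entropy bound is available for `a ≤ 7/10`, which covers the first two pieces of `u`. The middle
piece is the tangent to the concave entropy function at `1/2 - √3/4`, so there it follows from the
entropy bound (`entropy_le_tangent`). The inverse of `u` is checked piece by piece. -/

/-! ### The folded automaton and its walks -/

/-- The automaton on the states `0, …, K` that moves right from `s` on the letter `F s`, moves left
to `s` on the letter `B s`, and stays at `K` on the letters of `L`. -/
def foldedNFA {A : Type*} (F B : ℕ → A) (L : Finset A) (K e : ℕ) : NFA A (Fin (K + 1)) where
  step s a := {t | (t.val = s.val + 1 ∧ a = F s) ∨ (s.val = t.val + 1 ∧ a = B t) ∨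
    (s.val = K ∧ t.val = K ∧ a ∈ L)}
  start := {0}
  accept := {s | s.val = e}

/-- Words labelling a walk in `foldedNFA F B L K e` from a state to `e`; the Boolean
records the parity of the number of traversals of the loop, and has to be `true` at the end. -/
def FoldedWalk {A : Type*} (F B : ℕ → A) (L : Finset A) (K e : ℕ) : Bool → ℕ → List A → Prop
  | σ, s, [] => s = e ∧ σ = true
  | σ, s, a :: w => (s < K ∧ a = F s ∧ FoldedWalk F B L K e σ (s + 1) w) ∨
      (0 < s ∧ a = B (s - 1) ∧ FoldedWalk F B L K e σ (s - 1) w) ∨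
      (s = K ∧ a ∈ L ∧ FoldedWalk F B L K e (!σ) K w)

theorem NFA.mem_acceptsFrom_iff_exists {A S : Type*} (M : NFA A S) {T : Set S} {w : List A} :
    w ∈ M.acceptsFrom T ↔ ∃ t ∈ T, w ∈ M.acceptsFrom {t} := by
  simp only [NFA.mem_acceptsFrom]
  constructor
  · rintro ⟨s, hs, h⟩
    obtain ⟨t, ht, h⟩ := M.mem_evalFrom_iff_exists.1 h
    exact ⟨t, ht, s, hs, h⟩
  · rintro ⟨t, ht, s, hs, h⟩
    exact ⟨s, hs, M.mem_evalFrom_iff_exists.2 ⟨t, ht, h⟩⟩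

/-- The accepting run is at state `min t (min K (|x| + e - t))` at time `t`: up, around the loop
`|x| + e - 2K` times, and down to `e`. The letters on the way down are therefore indexed by `|x| + e
- i - 1`. The default `d` only makes the labels total. -/
theorem mem_foldedNFA_accepts {A : Type*} (K e : ℕ) (L : Finset A) (x : List A) (d : A)
    (he : e ≤ K) (hK : 2 * K ≤ x.length + e)
    (hL : ∀ t, K ≤ t → t + K < x.length + e → t < x.length → x.getD t d ∈ L) :
    x ∈ (foldedNFA (fun i => x.getD i d)
      (fun i => x.getD (x.length + e - i - 1) d) L K e).accepts := by
  let pos : ℕ → Fin (K + 1) := fun t => ⟨min t (min K (x.length + e - t)), by omega⟩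
  have key : ∀ r t, t + r = x.length → x.drop t ∈ (foldedNFA (fun i => x.getD i d)
      (fun i => x.getD (x.length + e - i - 1) d) L K e).acceptsFrom {pos t} := by
    intro r
    induction r with
    | zero =>
      intro t ht
      rw [List.drop_of_length_le (by omega), NFA.nil_mem_acceptsFrom]
      refine ⟨pos t, rfl, ?_⟩
      change min t (min K (x.length + e - t)) = e
      omega
    | succ r ih =>
      intro t ht
      have hlt : t < x.length := by omega
      rw [List.drop_eq_getElem_cons hlt, NFA.cons_mem_acceptsFrom, NFA.stepSet_singleton,
        NFA.mem_acceptsFrom_iff_exists]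
      refine ⟨pos (t + 1), ?_, ih (t + 1) (by omega)⟩
      have hx : ∀ i, i = t → x[t] = x.getD i d := by
        rintro i rfl
        exact (List.getD_eq_getElem _ _ hlt).symm
      rcases lt_or_ge t K with h | h
      · refine Or.inl ⟨?_, hx _ ?_⟩ <;> simp only [pos] <;> omega
      · rcases lt_or_ge (t + K) (x.length + e) with h' | h'
        · refine Or.inr (Or.inr ⟨?_, ?_, ?_⟩)
          · simp only [pos]; omega
          · simp only [pos]; omega
          · rw [hx t rfl]
            exact hL t h h' hlt
        · refine Or.inr (Or.inl ⟨?_, hx _ ?_⟩) <;> simp only [pos] <;> omega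
  have h0 : pos 0 = 0 := Fin.ext (by simp [pos])
  have := key x.length 0 (Nat.zero_add _)
  rwa [h0] at this

section Folded

variable {A : Type*} (F B : ℕ → A) (L : Finset A) (K e : ℕ)

/-- Every step except a loop changes the state by one, so the number of loops in a walk from `s` to
`e` has the parity of its length plus `s + e`. -/
theorem foldedWalk_of_mem_acceptsFrom (w : List A) (s : Fin (K + 1)) (σ : Bool)
    (hw : w ∈ (foldedNFA F B L K e).acceptsFrom {s})
    (hσ : σ = true ↔ Even (w.length + s + e)) : FoldedWalk F B L K e σ s w := by
  induction w generalizing s σ with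
  | nil =>
    have hs : s.val = e := by simpa [foldedNFA] using hw
    refine ⟨hs, hσ.2 ?_⟩
    rw [hs]; simp
  | cons a w ih =>
    rw [NFA.cons_mem_acceptsFrom, NFA.stepSet_singleton, NFA.mem_acceptsFrom_iff_exists] at hw
    obtain ⟨t, ht, hw⟩ := hw
    have hlen : (a :: w).length = w.length + 1 := rfl
    rw [hlen] at hσ
    rcases ht with ⟨h, ha⟩ | ⟨h, ha⟩ | ⟨h, h', ha⟩
    · refine Or.inl ⟨by have := t.2; omega, ha, ?_⟩
      rw [← h]
      exact ih t σ hw (hσ.trans (by rw [h]; grind))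
    · refine Or.inr (Or.inl ⟨by omega, by simpa [h] using ha, ?_⟩)
      rw [h, Nat.add_sub_cancel]
      exact ih t σ hw (hσ.trans (by rw [h]; grind))
    · refine Or.inr (Or.inr ⟨h, ha, ?_⟩)
      have := ih t (!σ) hw (by
        rw [h']
        rw [h] at hσ
        cases σ <;> simp at hσ ⊢ <;> grind)
      rwa [h'] at this

/-- The words of length `n` that label a walk. -/
def foldedWords (n : ℕ) (σ : Bool) (s : ℕ) : Set (List A) :=
  {w | w.length = n ∧ FoldedWalk F B L K e σ s w}

variable [Fintype A]

theorem finite_foldedWords (n : ℕ) (σ : Bool) (s : ℕ) : (foldedWords F B L K e n σ s).Finite :=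
  (List.finite_length_eq A n).subset fun _ h => h.1

/-- Split by the first step. This is only an inequality because one word may label several walks. -/
theorem ncard_foldedWords_succ_le (n : ℕ) (σ : Bool) (s : ℕ) :
    (foldedWords F B L K e (n + 1) σ s).ncard ≤
      (if s < K then (foldedWords F B L K e n σ (s + 1)).ncard else 0) +
      (if 0 < s then (foldedWords F B L K e n σ (s - 1)).ncard else 0) +
      (if s = K then L.card * (foldedWords F B L K e n (!σ) K).ncard else 0) := by
  have hfin := finite_foldedWords F B L K e n
  let S₁ : Set (List A) := if s < K then (F s :: ·) '' foldedWords F B L K e n σ (s + 1) else ∅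
  let S₂ : Set (List A) :=
    if 0 < s then (B (s - 1) :: ·) '' foldedWords F B L K e n σ (s - 1) else ∅
  let S₃ : Set (List A) :=
    if s = K then (fun y : A × List A => y.1 :: y.2) '' ((L : Set A) ×ˢ foldedWords F B L K e n (!σ) K)
    else ∅
  have hsub : foldedWords F B L K e (n + 1) σ s ⊆ S₁ ∪ S₂ ∪ S₃ := by
    rintro (_ | ⟨a, w⟩) ⟨hl, hw⟩
    · simp at hl
    · have hl' : w.length = n := by simpa using hl
      rcases hw with ⟨h, rfl, hw⟩ | ⟨h, rfl, hw⟩ | ⟨h, ha, hw⟩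
      · exact Or.inl (Or.inl (by simpa only [S₁, if_pos h] using ⟨w, ⟨hl', hw⟩, rfl⟩))
      · exact Or.inl (Or.inr (by simpa only [S₂, if_pos h] using ⟨w, ⟨hl', hw⟩, rfl⟩))
      · exact Or.inr (by simpa only [S₃, if_pos h] using ⟨(a, w), ⟨ha, hl', hw⟩, rfl⟩)
  have h₁ : S₁.Finite := by
    simp only [S₁]; split_ifs; exacts [(hfin _ _).image _, Set.finite_empty]
  have h₂ : S₂.Finite := by
    simp only [S₂]; split_ifs; exacts [(hfin _ _).image _, Set.finite_empty]
  have h₃ : S₃.Finite := by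
    simp only [S₃]; split_ifs
    exacts [(L.finite_toSet.prod (hfin _ _)).image _, Set.finite_empty]
  refine (Set.ncard_le_ncard hsub ((h₁.union h₂).union h₃)).trans <|
    (Set.ncard_union_le _ _).trans <| add_le_add ((Set.ncard_union_le _ _).trans <|
      add_le_add ?_ ?_) ?_
  · simp only [S₁]; split_ifs; exacts [Set.ncard_image_le (hfin _ _), by simp]
  · simp only [S₂]; split_ifs; exacts [Set.ncard_image_le (hfin _ _), by simp]
  · simp only [S₃]; split_ifs
    · refine (Set.ncard_image_le (L.finite_toSet.prod (hfin _ _))).trans ?_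
      rw [Set.ncard_prod, Set.ncard_coe_finset]
    · simp

/-! ### Counting walks by a supersolution -/

/-- A positive supersolution for the number of walks. -/
def foldedPotential (K : ℕ) (a b w : ℝ) : Bool → ℕ → ℝ
  | false, s => w ^ s
  | true, s => a * w ^ (2 * K - s) + b * w ^ s

/-- Away from the ends, `w ^ s` and `w ^ (-s)` are both eigenfunctions of the path for the
eigenvalue `w + w⁻¹`. The two equations for `a` and `b` are the eigenvalue conditions at `K` for the
two parities, with loop weight `c`. At state `0` there is no left neighbour, and only an inequality
remains. -/
theorem foldedPotential_step {K s : ℕ} {a b w c : ℝ} (ha : 0 ≤ a) (hb : 0 ≤ b) (hw : 0 < w)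
    (h₁ : c * (a + b) = w) (h₂ : b * w + a / w = c) (hs : s ≤ K) (σ : Bool) :
    (if s < K then foldedPotential K a b w σ (s + 1) else 0) +
      (if 0 < s then foldedPotential K a b w σ (s - 1) else 0) +
      (if s = K then c * foldedPotential K a b w (!σ) K else 0) ≤
      (w + w⁻¹) * foldedPotential K a b w σ s := by
  have h₂' : c * w = b * w ^ 2 + a := by rw [← h₂]; field_simp
  have hinv : w⁻¹ * w = 1 := inv_mul_cancel₀ hw.ne'
  rcases hs.lt_or_eq with h | rfl
  · rw [if_pos h, if_neg h.ne, add_zero]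
    have hr : 2 * K - s = 2 * K - (s + 1) + 1 := by omega
    rcases s with _ | r
    · rw [if_neg (lt_irrefl _), add_zero]
      cases σ
      · simpa [foldedPotential] using hw.le
      · simp only [foldedPotential, hr, zero_add, pow_one, pow_zero, mul_one]
        have e1 : 0 ≤ a * w ^ (2 * K - 1) * w * w := by positivity
        have e2 : 0 ≤ w⁻¹ * b := by positivity
        calc _ ≤ a * w ^ (2 * K - 1) + b * w + a * w ^ (2 * K - 1) * w * w + w⁻¹ * b := by linarith
          _ = _ := by
            rw [pow_succ]
            linear_combination -(a * w ^ (2 * K - 1)) * hinv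
    · rw [if_pos (Nat.succ_pos r)]
      refine le_of_eq ?_
      have e1 : 2 * K - r = 2 * K - (r + 1 + 1) + 2 := by omega
      cases σ
      · simp only [foldedPotential, Nat.add_sub_cancel]
        field_simp
        ring
      · simp only [foldedPotential, hr, Nat.add_sub_cancel, e1]
        field_simp
        ring
  · rw [if_neg (lt_irrefl _), if_pos rfl, zero_add]
    rcases s with _ | r
    · rw [if_neg (lt_irrefl _), zero_add]
      have := inv_pos.2 hw
      cases σ
      · simp only [foldedPotential, Bool.not_false, mul_zero, Nat.sub_zero, pow_zero]
        linarith
      · simp only [foldedPotential, Bool.not_true, mul_zero, Nat.sub_zero, pow_zero]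
        have : 0 ≤ w * a + w⁻¹ * b := by positivity
        rw [div_eq_inv_mul] at h₂
        linarith
    · rw [if_pos (Nat.succ_pos r)]
      refine le_of_eq ?_
      have e0 : 2 * (r + 1) - (r + 1) = r + 1 := by omega
      have e1 : 2 * (r + 1) - r = r + 2 := by omega
      cases σ
      · simp only [foldedPotential, e0, Bool.not_false, Nat.add_sub_cancel]
        linear_combination w ^ (r + 1) * h₁ - w ^ r * hinv
      · simp only [foldedPotential, e0, e1, Bool.not_true, Nat.add_sub_cancel]
        linear_combination w ^ r * h₂' - (a + b) * w ^ r * hinv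

/-- The transfer operator is monotone, so iterating the supersolution inequality `n` times bounds
the count. At length zero only the state `e` with parity `true` contributes. -/
theorem ncard_foldedWords_le {a b w : ℝ} (ha : 0 ≤ a) (hb : 0 ≤ b) (hw : 0 < w)
    (h₁ : L.card * (a + b) = w) (h₂ : b * w + a / w = L.card) (n : ℕ) (σ : Bool) {s : ℕ}
    (hs : s ≤ K) :
    (foldedWords F B L K e n σ s).ncard * foldedPotential K a b w true e ≤
      (w + w⁻¹) ^ n * foldedPotential K a b w σ s := by
  have hpos : ∀ σ s, 0 ≤ foldedPotential K a b w σ s := by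
    rintro (_ | _) s <;> simp only [foldedPotential] <;> positivity
  induction n generalizing σ s with
  | zero =>
    rw [pow_zero, one_mul]
    by_cases h : s = e ∧ σ = true
    · obtain ⟨rfl, rfl⟩ := h
      refine mul_le_of_le_one_left (hpos _ _) ?_
      have : foldedWords F B L K s 0 true s ⊆ {[]} := fun w hw => List.length_eq_zero_iff.1 hw.1
      exact_mod_cast (Set.ncard_le_ncard this).trans (Set.ncard_singleton _).le
    · have : foldedWords F B L K e 0 σ s = ∅ := by
        refine Set.eq_empty_of_forall_notMem ?_
        rintro w ⟨hl, hw⟩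
        obtain rfl := List.length_eq_zero_iff.1 hl
        exact h hw
      simp only [this, Set.ncard_empty, Nat.cast_zero, zero_mul]
      exact hpos _ _
  | succ n ih =>
    have hrec : ((foldedWords F B L K e (n + 1) σ s).ncard : ℝ) ≤ _ :=
      Nat.cast_le.2 (ncard_foldedWords_succ_le F B L K e n σ s)
    refine (mul_le_mul_of_nonneg_right hrec (hpos _ _)).trans ?_
    rw [pow_succ, mul_assoc]
    refine le_trans ?_ (mul_le_mul_of_nonneg_left
      (foldedPotential_step ha hb hw h₁ h₂ hs σ) (by positivity))
    push_cast
    rw [add_mul, add_mul, mul_add, mul_add]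
    refine add_le_add (add_le_add ?_ ?_) ?_
    · split_ifs with h
      · exact ih σ h
      · simp
    · split_ifs with h
      · exact ih σ (by omega)
      · simp
    · split_ifs with h
      · rw [mul_assoc, mul_left_comm _ (L.card : ℝ)]
        exact mul_le_mul_of_nonneg_left (ih (!σ) le_rfl) (by positivity)
      · simp

/-- The number of words of length `n` accepted by the folded automaton. -/
theorem ncard_foldedNFA_accepts_le {a b w : ℝ} (ha : 0 ≤ a) (hb : 0 ≤ b) (hw : 0 < w)
    (h₁ : L.card * (a + b) = w) (h₂ : b * w + a / w = L.card) {n : ℕ} (hn : Odd (n + e)) :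
    ({v | v ∈ (foldedNFA F B L K e).accepts ∧ v.length = n}.ncard : ℝ) *
      (a * w ^ (2 * K - e)) ≤ (w + w⁻¹) ^ n := by
  have hsub : {v | v ∈ (foldedNFA F B L K e).accepts ∧ v.length = n} ⊆
      foldedWords F B L K e n false 0 := by
    rintro v ⟨hv, rfl⟩
    -- Since `n + e` is odd, an odd number of loops remains, hence the parity `false`, where the
    -- potential at `0` is `1`.
    refine ⟨rfl, foldedWalk_of_mem_acceptsFrom F B L K e v 0 false hv ?_⟩
    simpa using hn
  have h := ncard_foldedWords_le F B L K e ha hb hw h₁ h₂ n false (Nat.zero_le K)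
  simp only [foldedPotential, pow_zero, mul_one] at h
  refine le_trans ?_ h
  refine mul_le_mul (Nat.cast_le.2 (Set.ncard_le_ncard hsub (finite_foldedWords ..)))
    (le_add_of_nonneg_right (by positivity)) (by positivity) (by positivity)

end Folded

/-! ### Existence of the minimum and the bound by half the length -/

theorem AcceptsWithin.of_foldedNFA {A : Type*} [Fintype A] (x : List A) (d : A) (L : Finset A)
    {K e m : ℕ} (he : e ≤ K) (hK : 2 * K ≤ x.length + e)
    (hL : ∀ t, K ≤ t → t + K < x.length + e → t < x.length → x.getD t d ∈ L)
    (hm : ∀ F B : ℕ → A, {v | v ∈ (foldedNFA F B L K e).accepts ∧ v.length = x.length}.ncard ≤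
      Fintype.card A ^ m) : AcceptsWithin x m (K + 1) :=
  ⟨_, ⟨0, rfl⟩, mem_foldedNFA_accepts K e L x d he hK hL, hm _ _⟩

/-- The supersolution bound is valid for every `w > 0`. With loop weight one, `a = w` and `b = 0` it
reads `(1 + w⁻²)^n`, which tends to `1` as `w → ∞`. -/
theorem ncard_foldedNFA_accepts_le_one {A : Type*} [Fintype A] (F B : ℕ → A) (l : A) {K e : ℕ}
    (he : e ≤ 1) (heK : e ≤ K) :
    {v | v ∈ (foldedNFA F B {l} K e).accepts ∧ v.length + e = 2 * K + 1}.ncard ≤ 1 := by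
  set S := {v | v ∈ (foldedNFA F B {l} K e).accepts ∧ v.length + e = 2 * K + 1}
  obtain ⟨n, hn⟩ : ∃ n, n + e = 2 * K + 1 := ⟨2 * K + 1 - e, by omega⟩
  have hS : S = {v | v ∈ (foldedNFA F B {l} K e).accepts ∧ v.length = n} := by
    ext v
    exact and_congr_right fun _ => by omega
  have hle : ∀ w : ℝ, 0 < w → (S.ncard : ℝ) ≤ (1 + (w⁻¹) ^ 2) ^ n := by
    intro w hw
    have h := ncard_foldedNFA_accepts_le F B {l} K e (a := w) (b := 0) hw.le le_rfl hw
      (by simp) (by simp [hw.ne']) (n := n) ⟨K, by omega⟩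
    rw [← hS, ← pow_succ', show 2 * K - e + 1 = n by omega, ← le_div_iff₀ (by positivity),
      ← div_pow] at h
    refine h.trans_eq ?_
    congr 1
    field_simp
  have hlim : Filter.Tendsto (fun w : ℝ => (1 + (w⁻¹) ^ 2) ^ n) Filter.atTop (nhds 1) := by
    have := ((tendsto_inv_atTop_zero (𝕜 := ℝ)).pow 2).const_add 1 |>.pow n
    simpa using this
  have := ge_of_tendsto hlim ((Filter.eventually_gt_atTop 0).mono hle)
  exact_mod_cast this

theorem acceptsWithin_half {A : Type*} [Fintype A] (x : List A) (m : ℕ) (hm : m ≤ x.length) :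
    AcceptsWithin x m (x.length / 2 + 1) := by
  rcases x with _ | ⟨d, y⟩
  -- The empty word is separate: the construction below would need `e = 1` and `K = 0`.
  · obtain rfl : m = 0 := by simpa using hm
    refine ⟨⟨fun _ _ => ∅, {0}, Set.univ⟩, ⟨0, rfl⟩, ⟨0, trivial, rfl⟩, ?_⟩
    refine (Set.ncard_le_ncard (t := {[]}) fun w hw => List.length_eq_zero_iff.1 hw.2).trans ?_
    simp
  · set x := d :: y with hx
    have hpos : 0 < x.length := by simp [hx]
    have hcard : 0 < Fintype.card A := Fintype.card_pos_iff.2 ⟨d⟩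
    -- This makes `|x| + e = 2 * (|x| / 2) + 1`, so `x` goes around the loop exactly once and one
    -- loop letter suffices.
    set e := (x.length + 1) % 2 with he
    refine AcceptsWithin.of_foldedNFA x d {x.getD (x.length / 2) d} (e := e) (by omega) (by omega)
      ?_ ?_
    · intro t ht h _
      rw [show t = x.length / 2 by omega]
      exact Finset.mem_singleton_self _
    · intro F B
      refine le_trans ?_ (Nat.one_le_pow _ _ hcard)
      have hS : {v | v ∈ (foldedNFA F B {x.getD (x.length / 2) d} (x.length / 2) e).accepts ∧
          v.length = x.length} =
          {v | v ∈ (foldedNFA F B {x.getD (x.length / 2) d} (x.length / 2) e).accepts ∧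
            v.length + e = 2 * (x.length / 2) + 1} :=
        Set.ext fun v => and_congr_right fun _ => by omega
      rw [hS]
      exact ncard_foldedNFA_accepts_le_one F B _ (by omega) (by omega)

theorem isLeast_structureFunction {A : Type*} [Fintype A] (x : List A) (m : ℕ)
    (hm : m ≤ x.length) :
    IsLeast {k : ℕ | AcceptsWithin x m k} (structureFunction x m) ∧
      structureFunction x m ≤ x.length / 2 + 1 :=
  ⟨⟨Nat.sInf_mem ⟨_, acceptsWithin_half x m hm⟩, fun _ h => Nat.sInf_le h⟩,
    Nat.sInf_le (acceptsWithin_half x m hm)⟩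

/-! ### The prefix automaton -/

/-- The automaton that reads `K` prescribed letters and then loops on every letter. -/
def prefixNFA {A : Type*} (F : ℕ → A) (K : ℕ) : NFA A (Fin (K + 1)) where
  step s a := {t | (t.val = s.val + 1 ∧ a = F s) ∨ (s.val = K ∧ t.val = K)}
  start := {0}
  accept := {s | s.val = K}

theorem mem_acceptsFrom_prefixNFA_iff {A : Type*} (F : ℕ → A) (K : ℕ) (w : List A)
    (s : Fin (K + 1)) : w ∈ (prefixNFA F K).acceptsFrom {s} ↔
      K ≤ s + w.length ∧ ∀ i, s.val + i < K → w[i]? = some (F (s + i)) := by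
  induction w generalizing s with
  | nil =>
    have hs := s.2
    rw [NFA.nil_mem_acceptsFrom]
    simp [prefixNFA]
    constructor
    · intro h; constructor <;> intros <;> omega
    · rintro ⟨h, -⟩; omega
  | cons a w ih =>
    rw [NFA.cons_mem_acceptsFrom, NFA.stepSet_singleton, NFA.mem_acceptsFrom_iff_exists]
    simp only [ih, List.length_cons]
    have hs := s.2
    constructor
    · rintro ⟨t, ⟨ht, rfl⟩ | ⟨hs', ht⟩, hl, hw⟩
      · refine ⟨by omega, ?_⟩
        rintro (_ | i) hi
        · rfl
        · rw [List.getElem?_cons_succ, hw i (by omega), ht, Nat.add_right_comm, Nat.add_assoc]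
      · exact ⟨by omega, fun i hi => by omega⟩
    · rintro ⟨hl, hw⟩
      rcases lt_or_ge s.val K with h | h
      · refine ⟨⟨s + 1, by omega⟩, Or.inl ⟨rfl, ?_⟩, by simp only; omega, ?_⟩
        · simpa using hw 0 (by simpa using h)
        · intro i hi
          simp only at hi ⊢
          have := hw (i + 1) (by omega)
          rw [List.getElem?_cons_succ] at this
          rw [this, Nat.add_right_comm, Nat.add_assoc]
      · exact ⟨s, Or.inr ⟨by omega, by omega⟩, by omega, fun i hi => by omega⟩

theorem acceptsWithin_prefix {A : Type*} [Fintype A] (x : List A) (m : ℕ) (hm : m ≤ x.length) :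
    AcceptsWithin x m (x.length - m + 1) := by
  rcases x with _ | ⟨d, y⟩
  · obtain rfl : m = 0 := by simpa using hm
    simpa using acceptsWithin_half ([] : List A) 0 le_rfl
  set x := d :: y with hx
  have hacc : ∀ w, w ∈ (prefixNFA (fun i => x.getD i d) (x.length - m)).accepts ↔ _ := fun w =>
    mem_acceptsFrom_prefixNFA_iff (fun i => x.getD i d) (x.length - m) w 0
  refine ⟨prefixNFA (fun i => x.getD i d) (x.length - m), ⟨0, rfl⟩, ?_, ?_⟩
  · refine (hacc x).2 ⟨by simp, fun i hi => ?_⟩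
    simp only [Fin.val_zero, zero_add] at hi ⊢
    rw [List.getD_eq_getElem _ _ (by omega : i < x.length), List.getElem?_eq_getElem]
  -- An accepted word of length `|x|` is determined by its last `m` letters.
  · have hle := Set.ncard_le_ncard_of_injOn (s := {w : List A |
      w ∈ (prefixNFA (fun i => x.getD i d) (x.length - m)).accepts ∧ w.length = x.length})
      (t := {w : List A | w.length = m}) (fun w => w.drop (x.length - m)) ?_ ?_
      (List.finite_length_eq A m)
    · refine hle.trans (le_of_eq ?_)
      rw [← Nat.card_coe_set_eq]
      change Nat.card (List.Vector A m) = _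
      rw [Nat.card_eq_fintype_card, card_vector]
    · rintro w ⟨-, hw⟩
      change (w.drop (x.length - m)).length = m
      rw [List.length_drop]
      omega
    · rintro v ⟨hv, hvl⟩ w ⟨hw, hwl⟩ h
      refine List.ext_getElem? fun i => ?_
      rcases lt_or_ge i (x.length - m) with hi | hi
      · have h1 := ((hacc v).1 hv).2 i (by simpa using hi)
        have h2 := ((hacc w).1 hw).2 i (by simpa using hi)
        rw [h1, h2]
      · have := congrArg (fun l => l[i - (x.length - m)]?) h
        simpa [List.getElem?_drop, Nat.add_sub_cancel' hi] using this

/-! ### The entropy bound for binary words -/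

/-- Solving the two equations for loop weight `2` gives `b = (3/2) / (w - w⁻¹)` and `a = w/2 - b`;
the condition `w > 2` makes `a` positive. The exponent `2K - 1` serves both parities of `|x|`. -/
theorem AcceptsWithin.of_pow_le {x : List Bool} {m K : ℕ} (hK : 1 ≤ K) (hKx : 2 * K ≤ x.length)
    {w : ℝ} (hw : 2 < w) (h : (w + w⁻¹) ^ x.length ≤
      2 ^ m * ((w / 2 - 3 / 2 / (w - w⁻¹)) * w ^ (2 * K - 1))) :
    AcceptsWithin x m (K + 1) := by
  have hinv : w⁻¹ < 1 / 2 := by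
    rw [inv_lt_comm₀ (by linarith) (by norm_num)]; linarith
  have hd : 0 < w - w⁻¹ := by linarith
  have ha : 0 < w / 2 - 3 / 2 / (w - w⁻¹) := by
    rw [sub_pos, div_lt_iff₀ hd]
    have : w * w⁻¹ = 1 := mul_inv_cancel₀ (by linarith)
    nlinarith
  have he : (x.length + 1) % 2 ≤ 1 := by omega
  refine AcceptsWithin.of_foldedNFA x false Finset.univ (e := (x.length + 1) % 2) (by omega)
    (by omega) (fun _ _ _ _ => Finset.mem_univ _) fun F B => ?_
  have hle := ncard_foldedNFA_accepts_le F B Finset.univ K ((x.length + 1) % 2)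
    (a := w / 2 - 3 / 2 / (w - w⁻¹)) (b := 3 / 2 / (w - w⁻¹)) (w := w) ha.le (by positivity)
    (by linarith) (by simp; ring) (by
      have h1 : 3 / 2 / (w - w⁻¹) * (w - w⁻¹) = 3 / 2 := div_mul_cancel₀ _ hd.ne'
      have h2 : w / 2 / w = 1 / 2 := by field_simp
      simp only [Finset.card_univ, Fintype.card_bool, sub_div, h2]
      push_cast
      rw [div_eq_mul_inv _ w]
      linear_combination h1) (n := x.length) (by
      rw [Nat.odd_iff]; omega)
  have hpow : w ^ (2 * K - 1) ≤ w ^ (2 * K - (x.length + 1) % 2) :=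
    pow_le_pow_right₀ (by linarith) (by omega)
  have h3 := hle.trans (h.trans (mul_le_mul_of_nonneg_left
    (mul_le_mul_of_nonneg_left hpow ha.le) (by positivity)))
  have h4 := le_of_mul_le_mul_right h3 (mul_pos ha (by positivity))
  rw [Fintype.card_bool]
  exact_mod_cast h4

/-- The choice `w² = (1 - q)/q` turns `w > 2` into `q < 1/5` and gives `log (w + w⁻¹) = H(q) log 2 +
(1 - 2q) log w`. The last term is cancelled by `w ^ (2K)` with `K ≈ (1/2 - q)n`. The slack `1/2` in
the bound on `m` allows for rounding. -/
theorem structureFunction_le_of_entropy {q : ℝ} (hq : 0 < q) (hq' : q < 1 / 5) :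
    ∃ C : ℝ, ∀ᶠ n : ℕ in Filter.atTop, ∀ x : List Bool, x.length = n → ∀ m : ℕ,
      entropy q * n - 1 / 2 ≤ m → (structureFunction x m : ℝ) ≤ (1 / 2 - q) * n + C := by
  set w := √((1 - q) / q) with hwdef
  have hw : 2 < w := by
    rw [hwdef, Real.lt_sqrt (by norm_num), lt_div_iff₀ hq]; linarith
  have hw0 : 0 < w := by linarith
  have hlogw : Real.log w = (Real.log (1 - q) - Real.log q) / 2 := by
    rw [hwdef, Real.log_sqrt (div_nonneg (by linarith) hq.le),
      Real.log_div (by linarith) hq.ne']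
  have hlw : 0 < Real.log w := Real.log_pos (by linarith)
  have hinv : w⁻¹ < 1 / 2 := by
    rw [inv_lt_comm₀ hw0 (by norm_num)]; linarith
  have hd : 0 < w - w⁻¹ := by linarith
  have hl2 : 0 < Real.log 2 := Real.log_pos (by norm_num)
  have hlam : Real.log (w + w⁻¹) = entropy q * Real.log 2 + (1 - 2 * q) * Real.log w := by
    have hw2 : w ^ 2 = (1 - q) / q := Real.sq_sqrt (div_nonneg (by linarith) hq.le)
    have h1 : w + w⁻¹ = w⁻¹ * q⁻¹ := by
      field_simp
      rw [hw2]
      field_simp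
      ring
    rw [h1, Real.log_mul (by positivity) (by positivity), Real.log_inv, Real.log_inv, entropy,
      div_mul_cancel₀ _ hl2.ne', Real.binEntropy_eq_negMulLog_add_negMulLog_one_sub,
      Real.negMulLog, Real.negMulLog, hlogw]
    ring
  set a := w / 2 - 3 / 2 / (w - w⁻¹) with hadef
  have ha : 0 < a := by
    rw [hadef, sub_pos, div_lt_iff₀ hd]
    have : w * w⁻¹ = 1 := mul_inv_cancel₀ (by linarith)
    nlinarith
  -- `J` extra states pay for the rounding of `m`, for the factor `a`, and for the `-1` in the
  -- exponent `2K - 1`.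
  obtain ⟨J, hJ⟩ := exists_nat_ge ((Real.log 2 / 2 - Real.log a + Real.log w) / (2 * Real.log w))
  rw [div_le_iff₀ (by positivity)] at hJ
  -- From this length on, `2K ≤ n`.
  obtain ⟨N, hN⟩ := exists_nat_ge ((2 * J + 4) / (2 * q))
  rw [div_le_iff₀ (by positivity)] at hN
  refine ⟨J + 3, Filter.eventually_atTop.2 ⟨N, fun n hn x hx m hm => ?_⟩⟩
  set K := ⌈(1 / 2 - q) * n⌉₊ + J + 1 with hKdef
  have hp : 0 ≤ (1 / 2 - q) * n := mul_nonneg (by linarith) (Nat.cast_nonneg n)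
  have hK1 : (1 / 2 - q) * n + J + 1 ≤ K := by
    rw [hKdef]; push_cast
    have := Nat.le_ceil ((1 / 2 - q) * n)
    linarith
  have hK2 : (K : ℝ) ≤ (1 / 2 - q) * n + J + 2 := by
    rw [hKdef]; push_cast
    have := (Nat.ceil_lt_add_one hp).le
    linarith
  have hKn : 2 * K ≤ n := by
    have hnN : (N : ℝ) ≤ n := Nat.cast_le.2 hn
    have : (N : ℝ) * (2 * q) ≤ n * (2 * q) := mul_le_mul_of_nonneg_right hnN (by linarith)
    have : (2 * K : ℝ) ≤ n := by linarith
    exact_mod_cast this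
  have hacc : AcceptsWithin x m (K + 1) := by
    refine AcceptsWithin.of_pow_le (by omega) (hx ▸ hKn) hw ?_
    rw [← Real.log_le_log_iff (by positivity) (by positivity), Real.log_pow, hlam, hx,
      Real.log_mul (by positivity) (by positivity), Real.log_mul ha.ne' (by positivity),
      Real.log_pow, Real.log_pow, Nat.cast_sub (by omega)]
    push_cast
    have h1 := mul_le_mul_of_nonneg_right hm hl2.le
    have h2 := mul_le_mul_of_nonneg_right hK1 hlw.le
    linarith
  have := Nat.sInf_le (s := {k | AcceptsWithin x m k}) hacc
  have : (structureFunction x m : ℝ) ≤ (K + 1 : ℕ) := Nat.cast_le.2 this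
  push_cast at this
  linarith

/-! ### Passage to the upper limit -/

theorem toNat_round_mul_le {a : ℝ} (ha : a ∈ Set.Icc (0 : ℝ) 1) (n : ℕ) :
    (round (a * n)).toNat ≤ n := by
  have h1 : a * n ≤ n := mul_le_of_le_one_left (Nat.cast_nonneg n) ha.2
  have h2 := round_le_add_half (a * n)
  have h3 : (round (a * n) : ℝ) < (n : ℤ) + 1 := by push_cast; linarith
  have h4 : round (a * n) < (n : ℤ) + 1 := by exact_mod_cast h3
  omega

theorem le_toNat_round_mul {a : ℝ} (n : ℕ) : a * n - 1 / 2 ≤ (round (a * n)).toNat := by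
  have h2 := sub_half_lt_round (a * n)
  have h3 : (round (a * n) : ℝ) ≤ ((round (a * n)).toNat : ℤ) := by
    exact_mod_cast Int.self_le_toNat _
  push_cast at h3
  linarith

theorem hTilde_le_of_eventually_le {a p C : ℝ} (h : ∀ᶠ n : ℕ in Filter.atTop, ∀ x : List Bool,
    x.length = n → (structureFunction x (round (a * n)).toNat : ℝ) ≤ p * n + C) :
    hTilde a ≤ p := by
  have hlim : Filter.Tendsto (fun n : ℕ => p + C / n) Filter.atTop (nhds p) := by
    simpa using (tendsto_const_div_atTop_nhds_zero_nat C).const_add p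
  rw [← hlim.limsup_eq]
  refine Filter.limsup_le_limsup ?_ ?_ hlim.isBoundedUnder_le
  · filter_upwards [h, Filter.eventually_gt_atTop 0] with n hn hn0
    have : (0 : ℝ) < n := Nat.cast_pos.2 hn0
    refine ciSup_le fun x => ?_
    rw [div_le_iff₀ this, add_mul, div_mul_cancel₀ _ this.ne']
    exact hn _ (List.length_ofFn)
  · exact Filter.isCoboundedUnder_le_of_le Filter.atTop (x := 0)
      fun n => Real.iSup_nonneg fun x => by positivity

theorem hTilde_mem_Icc {a : ℝ} (ha : a ∈ Set.Icc (0 : ℝ) 1) :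
    hTilde a ∈ Set.Icc (0 : ℝ) (1 / 2) := by
  have hb : ∀ n : ℕ, ∀ x : List Bool, x.length = n →
      (structureFunction x (round (a * n)).toNat : ℝ) ≤ 1 / 2 * n + 1 := by
    intro n x hx
    have h := (isLeast_structureFunction x _ (hx ▸ toNat_round_mul_le ha n)).2
    have h' : (structureFunction x (round (a * n)).toNat : ℝ) ≤ (n / 2 + 1 : ℕ) := by
      subst hx; exact Nat.cast_le.2 h
    have h'' : ((n / 2 : ℕ) : ℝ) ≤ n / 2 := Nat.cast_div_le
    push_cast at h'
    linarith
  refine ⟨?_, hTilde_le_of_eventually_le (Filter.Eventually.of_forall hb)⟩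
  refine Filter.le_limsup_of_frequently_le
    (Filter.Frequently.of_forall fun n => Real.iSup_nonneg fun x => by positivity) ?_
  refine Filter.isBoundedUnder_of ⟨3 / 2, fun n => ciSup_le fun x => ?_⟩
  rcases Nat.eq_zero_or_pos n with rfl | hn
  · norm_num
  · have h1 : (1 : ℝ) ≤ n := Nat.one_le_cast.2 hn
    rw [div_le_iff₀ (by linarith)]
    have := hb n _ (List.length_ofFn (f := x))
    linarith

theorem hTilde_le_one_sub {a : ℝ} (ha : a ∈ Set.Icc (0 : ℝ) 1) : hTilde a ≤ 1 - a := by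
  refine hTilde_le_of_eventually_le (C := 3 / 2) (Filter.Eventually.of_forall fun n x hx => ?_)
  subst hx
  have hm := toNat_round_mul_le ha x.length
  have h := Nat.sInf_le (s := {k | AcceptsWithin x _ k}) (acceptsWithin_prefix x _ hm)
  have h' : (structureFunction x (round (a * x.length)).toNat : ℝ) ≤
    (x.length - (round (a * x.length)).toNat + 1 : ℕ) := Nat.cast_le.2 h
  rw [Nat.cast_add, Nat.cast_sub hm] at h'
  have := le_toNat_round_mul (a := a) x.length
  push_cast at h'
  linarith

theorem hTilde_entropy_le {q : ℝ} (hq : 0 < q) (hq' : q < 1 / 5) :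
    hTilde (entropy q) ≤ 1 / 2 - q := by
  obtain ⟨C, hC⟩ := structureFunction_le_of_entropy hq hq'
  refine hTilde_le_of_eventually_le (C := C) ?_
  filter_upwards [hC] with n hn x hx
  exact hn x hx _ (le_toNat_round_mul n)

/-! ### Entropy, the tangent and the constants -/

theorem entropy_strictMonoOn : StrictMonoOn entropy (Set.Icc 0 (1 / 2)) := by
  intro x hx y hy h
  rw [one_div] at hx hy
  exact div_lt_div_of_pos_right (Real.binEntropy_strictMonoOn hx hy h)
    (Real.log_pos (by norm_num))

theorem entropyInv_spec {a : ℝ} (ha : a ∈ Set.Icc (0 : ℝ) 1) :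
    entropy (entropyInv a) = a ∧ 0 ≤ entropyInv a ∧ entropyInv a ≤ 1 / 2 :=
  (entropyInv_eq_iff ha).1 rfl

theorem entropy_zero : entropy 0 = 0 := by simp [entropy]

theorem entropy_half : entropy (1 / 2) = 1 := by
  simp [entropy, (Real.log_pos one_lt_two).ne']

/-- Since `H(1/5) = log₂ 5 - 8/5`, this amounts to `2 ^ 23 < 5 ^ 10`. It ensures that `H⁻¹(a) < 1/5`
for `a ≤ 7/10`. -/
theorem seven_tenths_lt_entropy : 7 / 10 < entropy (1 / 5) := by
  have hl : 0 < Real.log 2 := Real.log_pos (by norm_num)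
  have h1 : Real.log ((2 : ℝ) ^ 23) < Real.log ((5 : ℝ) ^ 10) :=
    Real.log_lt_log (by norm_num) (by norm_num)
  rw [Real.log_pow, Real.log_pow] at h1
  have h2 : Real.log ((1 - 1 / 5 : ℝ)⁻¹) = Real.log 5 - 2 * Real.log 2 := by
    rw [show ((1 - 1 / 5 : ℝ)⁻¹) = 5 / 2 ^ 2 by norm_num, Real.log_div (by norm_num) (by norm_num),
      Real.log_pow]
    norm_num
  have h3 : Real.log ((1 / 5 : ℝ)⁻¹) = Real.log 5 := by norm_num
  rw [entropy, lt_div_iff₀ hl, Real.binEntropy, h2, h3]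
  norm_num at h1 ⊢
  linarith

theorem sqrt_three_bounds : 1.73205080 < √3 ∧ √3 < 1.73205081 :=
  ⟨Real.lt_sqrt_of_sq_lt (by norm_num), (Real.sqrt_lt' (by norm_num)).2 (by norm_num)⟩

/-- The two arguments are `(2 ∓ √3) / 4`, and `2 - √3` is the inverse of `2 + √3`. -/
theorem log_half_sub_sqrt_three :
    Real.log (1 / 2 - √3 / 4) = -Real.log (2 + √3) - 2 * Real.log 2 ∧
      Real.log (1 - (1 / 2 - √3 / 4)) = Real.log (2 + √3) - 2 * Real.log 2 := by
  have h3 : √3 ^ 2 = 3 := Real.sq_sqrt (by norm_num)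
  have h4 : 2 * Real.log 2 = Real.log 4 := by
    rw [show (4 : ℝ) = 2 ^ 2 by norm_num, Real.log_pow]; norm_num
  have hp : 0 < 2 + √3 := by positivity
  rw [h4]
  constructor
  · rw [← Real.log_inv, ← Real.log_div (by positivity) (by norm_num)]
    congr 1
    field_simp
    linear_combination -2 * h3
  · rw [← Real.log_div hp.ne' (by norm_num)]
    congr 1
    ring

/-- The Gibbs inequality against the tangent at `1 / 2 - √3 / 4`. -/
theorem entropy_le_tangent {q : ℝ} (h0 : 0 < q) (h1 : q < 1) :
    entropy q ≤ 2 - 2 * (Real.log (2 + √3) / Real.log 2) * (1 / 2 - q) := by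
  have hl : 0 < Real.log 2 := Real.log_pos (by norm_num)
  obtain ⟨e1, e2⟩ := log_half_sub_sqrt_three
  obtain ⟨s1, s2⟩ := sqrt_three_bounds
  have hq0 : 0 < 1 / 2 - √3 / 4 := by linarith
  have hq1 : 0 < 1 - (1 / 2 - √3 / 4) := by linarith
  have h1' : 0 < 1 - q := by linarith
  -- Use `log t ≤ t - 1` at the ratios of the tangency probabilities to `q` and `1 - q`; the
  -- weighted right-hand sides sum to zero.
  have g1 := mul_le_mul_of_nonneg_left (Real.log_le_sub_one_of_pos (div_pos hq0 h0)) h0.le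
  have g2 := mul_le_mul_of_nonneg_left (Real.log_le_sub_one_of_pos (div_pos hq1 h1')) h1'.le
  rw [Real.log_div hq0.ne' h0.ne', e1, mul_sub q (_ / q), mul_div_cancel₀ _ h0.ne'] at g1
  rw [Real.log_div hq1.ne' h1'.ne', e2, mul_sub (1 - q) (_ / (1 - q)),
    mul_div_cancel₀ _ h1'.ne'] at g2
  rw [entropy, div_le_iff₀ hl, Real.binEntropy_eq_negMulLog_add_negMulLog_one_sub,
      Real.negMulLog, Real.negMulLog]
  have : (2 - 2 * (Real.log (2 + √3) / Real.log 2) * (1 / 2 - q)) * Real.log 2 =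
      2 * Real.log 2 - 2 * Real.log (2 + √3) * (1 / 2 - q) := by
    field_simp
  rw [this]
  linarith

theorem entropy_half_sub_sqrt_three :
    entropy (1 / 2 - √3 / 4) = 2 - √3 / 2 * (Real.log (2 + √3) / Real.log 2) := by
  have hl : 0 < Real.log 2 := Real.log_pos (by norm_num)
  obtain ⟨e1, e2⟩ := log_half_sub_sqrt_three
  rw [entropy, div_eq_iff hl.ne', Real.binEntropy_eq_negMulLog_add_negMulLog_one_sub,
      Real.negMulLog, Real.negMulLog, e1, e2]
  field_simp
  ring

theorem alphaConst_eq : alphaConst = 2 * (Real.log (2 + √3) / Real.log 2) := by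
  have : 0 < √3 := by positivity
  rw [alphaConst, entropy_half_sub_sqrt_three]
  field_simp
  ring

theorem hasDerivAt_entropy : HasDerivAt entropy alphaConst (1 / 2 - √3 / 4) := by
  obtain ⟨e1, e2⟩ := log_half_sub_sqrt_three
  obtain ⟨s1, s2⟩ := sqrt_three_bounds
  have h := (Real.hasDerivAt_binEntropy (p := 1 / 2 - √3 / 4) (by linarith) (by linarith)).div_const
    (Real.log 2)
  rw [e1, e2] at h
  refine h.congr_deriv ?_
  rw [alphaConst_eq]
  ring

/-- Here `α = 2 log₂ (2 + √3)`, and `(2 + √3)^10` is very close to `2 ^ 19`. Their ratio `r` is so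
near `1` that `1 - r⁻¹ ≤ log r ≤ r - 1` is precise enough. -/
theorem alphaConst_bounds : 3.799936 < alphaConst ∧ alphaConst < 3.799938 := by
  have hl1 := Real.log_two_gt_d9
  have hl2 := Real.log_two_lt_d9
  have hl : 0 < Real.log 2 := by linarith
  obtain ⟨s1, s2⟩ := sqrt_three_bounds
  have h3 : √3 ^ 2 = 3 := Real.sq_sqrt (by norm_num)
  have hX : (2 + √3) ^ 10 = 262087 + 151316 * √3 := by
    have a2 : (2 + √3) ^ 2 = 7 + 4 * √3 := by linear_combination h3
    have a4 : (2 + √3) ^ 4 = 97 + 56 * √3 := by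
      rw [show (2 + √3) ^ 4 = ((2 + √3) ^ 2) ^ 2 by ring, a2]; linear_combination 16 * h3
    have a8 : (2 + √3) ^ 8 = 18817 + 10864 * √3 := by
      rw [show (2 + √3) ^ 8 = ((2 + √3) ^ 4) ^ 2 by ring, a4]; linear_combination 3136 * h3
    rw [show (2 + √3) ^ 10 = (2 + √3) ^ 8 * (2 + √3) ^ 2 by ring, a8, a2]
    linear_combination 43456 * h3
  set r := (262087 + 151316 * √3) / 2 ^ 19 with hr
  have hr0 : 0 < r := by positivity
  have hr1 : r ≤ 1 - 217430 / 10 ^ 9 := by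
    rw [hr, div_le_iff₀ (by norm_num)]; linarith
  have hr2 : 1 - 217460 / 10 ^ 9 ≤ r := by
    rw [hr, le_div_iff₀ (by norm_num)]; linarith
  have hlog : 10 * Real.log (2 + √3) = 19 * Real.log 2 + Real.log r := by
    have h1 := congrArg Real.log hX
    rw [Real.log_pow] at h1
    rw [hr, Real.log_div (by positivity) (by positivity), Real.log_pow, ← h1]
    push_cast
    ring
  have hlr1 := Real.log_le_sub_one_of_pos hr0
  have hlr2 := Real.one_sub_inv_le_log_of_pos hr0
  have hri : r⁻¹ ≤ 1 + 217520 / 10 ^ 9 := by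
    rw [inv_le_comm₀ hr0 (by norm_num)]
    refine le_trans ?_ hr2
    norm_num
  rw [alphaConst_eq, mul_div_assoc', lt_div_iff₀ hl, div_lt_iff₀ hl]
  constructor <;> linarith

theorem entropy_eq_two_sub : entropy (1 / 2 - √3 / 4) = 2 - alphaConst * (√3 / 4) := by
  rw [alphaConst_eq, entropy_half_sub_sqrt_three]; ring

theorem entropy_half_sub_sqrt_three_bounds :
    0.354 < entropy (1 / 2 - √3 / 4) ∧ entropy (1 / 2 - √3 / 4) < 0.355 := by
  obtain ⟨s1, s2⟩ := sqrt_three_bounds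
  obtain ⟨a1, a2⟩ := alphaConst_bounds
  rw [entropy_eq_two_sub]
  constructor <;> nlinarith

theorem second_breakpoint_bounds : 0.642 < (alphaConst - 2) / (alphaConst - 1) ∧
    (alphaConst - 2) / (alphaConst - 1) < 0.643 := by
  obtain ⟨a1, a2⟩ := alphaConst_bounds
  rw [lt_div_iff₀ (by linarith), div_lt_iff₀ (by linarith)]
  constructor <;> linarith

theorem second_breakpoint_eq :
    (alphaConst - 2) / (alphaConst - 1) = 1 - 1 / (alphaConst - 1) := by
  obtain ⟨a1, a2⟩ := alphaConst_bounds
  rw [eq_sub_iff_add_eq, ← add_div, div_eq_one_iff_eq (by linarith)]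
  ring

/-- This says that the lines `2 - αp` and `1 - p` meet at `p = 1/(α - 1)`. -/
theorem alphaConst_mul_inv :
    alphaConst * (1 / (alphaConst - 1)) = 1 + 1 / (alphaConst - 1) := by
  obtain ⟨a1, a2⟩ := alphaConst_bounds
  have : alphaConst - 1 ≠ 0 := by linarith
  field_simp
  ring

/-! ### The pieces of the bound and of its inverse -/

theorem upperBound_of_le_of_le {a : ℝ} (h₁ : entropy (1 / 2 - √3 / 4) ≤ a)
    (h₂ : a ≤ (alphaConst - 2) / (alphaConst - 1)) : upperBound a = (2 - a) / alphaConst := by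
  obtain ⟨a1, a2⟩ := alphaConst_bounds
  obtain ⟨s1, s2⟩ := sqrt_three_bounds
  obtain ⟨e1, e2⟩ := entropy_half_sub_sqrt_three_bounds
  rw [upperBound]
  split_ifs with h
  · obtain rfl := le_antisymm h h₁
    rw [(entropyInv_eq_iff (x := 1 / 2 - √3 / 4) ⟨by linarith, by linarith⟩).2
      ⟨rfl, by linarith, by linarith⟩, entropy_eq_two_sub, eq_div_iff (by linarith)]
    ring
  · rfl

theorem upperBound_of_ge {a : ℝ} (h : (alphaConst - 2) / (alphaConst - 1) ≤ a) :
    upperBound a = 1 - a := by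
  obtain ⟨a1, a2⟩ := alphaConst_bounds
  obtain ⟨e1, e2⟩ := entropy_half_sub_sqrt_three_bounds
  obtain ⟨b1, b2⟩ := second_breakpoint_bounds
  rw [upperBound, if_neg (by linarith)]
  split_ifs with h'
  · obtain rfl := le_antisymm h' h
    rw [div_eq_iff (by linarith), second_breakpoint_eq]
    linear_combination -alphaConst_mul_inv
  · rfl

theorem inv_alphaConst_bounds :
    0.357 < 1 / (alphaConst - 1) ∧ 1 / (alphaConst - 1) < 0.358 := by
  obtain ⟨b1, b2⟩ := second_breakpoint_bounds
  rw [second_breakpoint_eq] at b1 b2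
  constructor <;> linarith

theorem upperBoundInv_of_le_of_le {p : ℝ} (h₁ : 1 / (alphaConst - 1) ≤ p) (h₂ : p ≤ √3 / 4) :
    upperBoundInv p = 2 - alphaConst * p := by
  rw [upperBoundInv]
  split_ifs with h
  · obtain rfl := le_antisymm h h₂
    exact entropy_eq_two_sub
  · rfl

theorem upperBoundInv_of_le {p : ℝ} (h : p ≤ 1 / (alphaConst - 1)) : upperBoundInv p = 1 - p := by
  obtain ⟨r1, r2⟩ := inv_alphaConst_bounds
  obtain ⟨s1, s2⟩ := sqrt_three_bounds
  rw [upperBoundInv, if_neg (by linarith)]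
  split_ifs with h'
  · obtain rfl := le_antisymm h h'
    linear_combination -alphaConst_mul_inv
  · rfl

theorem upperBoundInv_of_ge {p : ℝ} (h : √3 / 4 ≤ p) : upperBoundInv p = entropy (1 / 2 - p) :=
  if_pos h

theorem upperBound_of_le {a : ℝ} (h : a ≤ entropy (1 / 2 - √3 / 4)) :
    upperBound a = 1 / 2 - entropyInv a := if_pos h

theorem upperBound_mem_and_leftInv {a : ℝ} (ha : a ∈ Set.Icc (0 : ℝ) 1) :
    upperBound a ∈ Set.Icc (0 : ℝ) (1 / 2) ∧ upperBoundInv (upperBound a) = a := by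
  obtain ⟨a1, a2⟩ := alphaConst_bounds
  obtain ⟨s1, s2⟩ := sqrt_three_bounds
  obtain ⟨r1, r2⟩ := inv_alphaConst_bounds
  have hd := second_breakpoint_eq
  have hα : 0 < alphaConst := by linarith
  rcases le_total a (entropy (1 / 2 - √3 / 4)) with h | h
  · obtain ⟨q1, q2, q3⟩ := entropyInv_spec ha
    have hq : entropyInv a ≤ 1 / 2 - √3 / 4 :=
      (entropy_strictMonoOn.le_iff_le ⟨q2, q3⟩ ⟨by linarith, by linarith⟩).1 (q1.symm ▸ h)
    rw [upperBound_of_le h, upperBoundInv_of_ge (by linarith), sub_sub_cancel, q1]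
    exact ⟨⟨by linarith, by linarith⟩, rfl⟩
  rcases le_total a ((alphaConst - 2) / (alphaConst - 1)) with h' | h'
  · have h1 : 1 / (alphaConst - 1) ≤ (2 - a) / alphaConst := by
      rw [le_div_iff₀ hα, mul_comm, alphaConst_mul_inv]; linarith
    have h2 : (2 - a) / alphaConst ≤ √3 / 4 := by
      rw [entropy_eq_two_sub] at h
      rw [div_le_iff₀ hα]; linarith
    rw [upperBound_of_le_of_le h h', upperBoundInv_of_le_of_le h1 h2, mul_div_cancel₀ _ hα.ne']
    exact ⟨⟨by linarith, by linarith⟩, by ring⟩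
  · rw [upperBound_of_ge h', upperBoundInv_of_le (by linarith)]
    exact ⟨⟨by linarith [ha.2], by linarith⟩, by ring⟩

theorem upperBoundInv_mem_and_leftInv {p : ℝ} (hp : p ∈ Set.Icc (0 : ℝ) (1 / 2)) :
    upperBoundInv p ∈ Set.Icc (0 : ℝ) 1 ∧ upperBound (upperBoundInv p) = p := by
  obtain ⟨a1, a2⟩ := alphaConst_bounds
  obtain ⟨s1, s2⟩ := sqrt_three_bounds
  obtain ⟨r1, r2⟩ := inv_alphaConst_bounds
  obtain ⟨e1, e2⟩ := entropy_half_sub_sqrt_three_bounds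
  obtain ⟨p1, p2⟩ := hp
  have hd := second_breakpoint_eq
  have hα : 0 < alphaConst := by linarith
  rcases le_total (√3 / 4) p with h | h
  · have hmono := entropy_strictMonoOn.monotoneOn
    have h1 : entropy (1 / 2 - p) ≤ entropy (1 / 2 - √3 / 4) :=
      hmono ⟨by linarith, by linarith⟩ ⟨by linarith, by linarith⟩ (by linarith)
    have h2 : entropy 0 ≤ entropy (1 / 2 - p) :=
      hmono ⟨le_rfl, by norm_num⟩ ⟨by linarith, by linarith⟩ (by linarith)
    rw [entropy_zero] at h2
    have hm : entropy (1 / 2 - p) ∈ Set.Icc (0 : ℝ) 1 := ⟨h2, by linarith⟩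
    rw [upperBoundInv_of_ge h, upperBound_of_le h1,
      (entropyInv_eq_iff hm).2 ⟨rfl, by linarith, by linarith⟩]
    exact ⟨hm, by ring⟩
  rcases le_total (1 / (alphaConst - 1)) p with h' | h'
  · have h1 := mul_le_mul_of_nonneg_left h hα.le
    have h2 := mul_le_mul_of_nonneg_left h' hα.le
    rw [alphaConst_mul_inv] at h2
    rw [entropy_eq_two_sub] at e1 e2
    rw [upperBoundInv_of_le_of_le h' h, upperBound_of_le_of_le
      (by rw [entropy_eq_two_sub]; linarith) (by linarith), eq_comm, eq_div_iff hα.ne']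
    exact ⟨⟨by linarith, by linarith⟩, by ring⟩
  · rw [upperBoundInv_of_le h', upperBound_of_ge (by linarith)]
    exact ⟨⟨by linarith, by linarith⟩, by ring⟩

/-! ### Comparison with the bound -/

theorem hTilde_le_half_sub_entropyInv {a : ℝ} (h0 : 0 ≤ a) (h : a ≤ 7 / 10) :
    hTilde a ≤ 1 / 2 - entropyInv a := by
  have ha : a ∈ Set.Icc (0 : ℝ) 1 := ⟨h0, by linarith⟩
  obtain ⟨q1, q2, q3⟩ := entropyInv_spec ha
  -- The entropy bound needs `q > 0`; at `q = 0` the general bound `1/2` is the claim.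
  rcases q2.eq_or_lt with hq | hq
  · rw [← hq, sub_zero]
    exact (hTilde_mem_Icc ha).2
  · have := (entropy_strictMonoOn.lt_iff_lt ⟨q2, q3⟩ ⟨by norm_num, by norm_num⟩).1
      (q1.trans_lt (h.trans_lt seven_tenths_lt_entropy))
    have h := hTilde_entropy_le hq this
    rwa [q1] at h

theorem hTilde_le_upperBound {a : ℝ} (ha : a ∈ Set.Icc (0 : ℝ) 1) : hTilde a ≤ upperBound a := by
  obtain ⟨a1, a2⟩ := alphaConst_bounds
  obtain ⟨e1, e2⟩ := entropy_half_sub_sqrt_three_bounds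
  obtain ⟨b1, b2⟩ := second_breakpoint_bounds
  rcases le_total a (entropy (1 / 2 - √3 / 4)) with h | h
  · rw [upperBound_of_le h]
    exact hTilde_le_half_sub_entropyInv ha.1 (by linarith)
  rcases le_total a ((alphaConst - 2) / (alphaConst - 1)) with h' | h'
  · rw [upperBound_of_le_of_le h h']
    -- The second breakpoint is below `7/10`, so the entropy bound still applies, and the tangent
    -- inequality weakens it to the linear piece.
    refine (hTilde_le_half_sub_entropyInv ha.1 (by linarith)).trans ?_
    obtain ⟨q1, q2, q3⟩ := entropyInv_spec ha
    have hq : 0 < entropyInv a := q2.lt_of_ne fun h => by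
      rw [← h, entropy_zero] at q1
      linarith
    have := entropy_le_tangent hq (by linarith)
    rw [q1, ← alphaConst_eq] at this
    rw [le_div_iff₀ (by linarith)]
    linarith
  · rw [upperBound_of_ge h']
    exact hTilde_le_one_sub ha

theorem mainTheorem1 :
    -- the minimum defining `h_x(m)` exists, and `h_x : [0, n] → [0, ⌊n/2⌋ + 1]`, for every alphabet
    (∀ {A : Type*} [Fintype A] (x : List A) (m : ℕ), m ≤ x.length →
      IsLeast {k : ℕ | AcceptsWithin x m k} (structureFunction x m) ∧
        structureFunction x m ≤ x.length / 2 + 1) ∧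
    -- `h̃ : [0, 1] → [0, 1/2]`, and `h̃ ≤ u`
    (∀ a ∈ Set.Icc (0 : ℝ) 1,
      hTilde a ∈ Set.Icc (0 : ℝ) (1 / 2) ∧ hTilde a ≤ upperBound a) ∧
    -- the pieces of `u` agree where their ranges overlap
    (∀ a : ℝ, entropy (1 / 2 - √3 / 4) ≤ a → a ≤ (alphaConst - 2) / (alphaConst - 1) →
      upperBound a = (2 - a) / alphaConst) ∧
    (∀ a : ℝ, (alphaConst - 2) / (alphaConst - 1) ≤ a → upperBound a = 1 - a) ∧
    -- `α` is the derivative of the entropy function, and the numerical values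
    HasDerivAt entropy alphaConst (1 / 2 - √3 / 4) ∧
    |entropy (1 / 2 - √3 / 4) - 0.35| < 0.005 ∧
    |(alphaConst - 2) / (alphaConst - 1) - 0.64| < 0.005 ∧
    |alphaConst - 3.79994| < 0.000005 ∧
    -- `u : [0, 1] → [0, 1/2]` is a bijection with the displayed inverse,
    -- whose pieces agree where their ranges overlap
    Set.BijOn upperBound (Set.Icc 0 1) (Set.Icc 0 (1 / 2)) ∧
    Set.InvOn upperBoundInv upperBound (Set.Icc 0 1) (Set.Icc 0 (1 / 2)) ∧
    (∀ p : ℝ, 1 / (alphaConst - 1) ≤ p → p ≤ √3 / 4 →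
      upperBoundInv p = 2 - alphaConst * p) ∧
    (∀ p : ℝ, p ≤ 1 / (alphaConst - 1) → upperBoundInv p = 1 - p) := by
  obtain ⟨a1, a2⟩ := alphaConst_bounds
  obtain ⟨e1, e2⟩ := entropy_half_sub_sqrt_three_bounds
  obtain ⟨b1, b2⟩ := second_breakpoint_bounds
  have hinv : Set.InvOn upperBoundInv upperBound (Set.Icc 0 1) (Set.Icc 0 (1 / 2)) :=
    ⟨fun _ ha => (upperBound_mem_and_leftInv ha).2, fun _ hp => (upperBoundInv_mem_and_leftInv hp).2⟩
  refine ⟨fun x m hm => isLeast_structureFunction x m hm,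
    fun a ha => ⟨hTilde_mem_Icc ha, hTilde_le_upperBound ha⟩,
    fun a => upperBound_of_le_of_le, fun a => upperBound_of_ge, hasDerivAt_entropy, ?_, ?_, ?_,
    hinv.bijOn (fun _ ha => (upperBound_mem_and_leftInv ha).1)
      (fun _ hp => (upperBoundInv_mem_and_leftInv hp).1), hinv,
    fun p => upperBoundInv_of_le_of_le, fun p => upperBoundInv_of_le⟩
  all_goals rw [abs_lt]; constructor <;> linarith
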